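/- Consider a network game with $N$ players. Let $G\in\mathbb{R}^{N\times N}$ be entrywise non-negative with $G_{ii}=0$. Player $i$ chooses $x^i$ in a set $\mathcal X^i\subseteq\mathbb R^n$ to minimize a cost $J^i(x^i,z^i(x))$, where $z^i(x)=\sum_{j=1}^N G_{ij}x^j$; write $\mathcal X=\mathcal X^1\times\dots\times\mathcal X^N$, $\mathcal Z^i=\{z^i(x):x\in\mathcal X\}$, $B^i(z)=\arg\min_{y\in\mathcal X^i}J^i(y,z)$ and $F(x)=[\nabla_{x^i}J^i(x^i,z^i(x))]_{i=1}^N$. A profile $x^\star\in\mathcal X$ is a Nash equilibrium if $x^{\star i}\in B^i(z^i(x^\star))$ for all $i$. Assume that for every $i$: $\mathcal X^i$ is nonempty, closed and convex; for each $z\in\mathcal Z^i$ the function $J^i(\cdot,z)$ is continuously differentiable and convex on $\mathcal X^i$; $J^i$ is twice differentiable in $[x^i;z^i]$ at every point of $\mathcal X^i\times\mathcal Z^i$; and $\nabla_{x^i}J^i$ is Lipschitz on $\mathcal X^i\times\mathcal Z^i$. Let $A_{i,j}(x)=\partial F^i(x)/\partial x^j\in\mathbb R^{n\times n}$ be the blocks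 of $\nabla_xF(x)$, and suppose that $\nabla_x F$ satisfies the $P_\Upsilon$ condition over $\mathcal X$, that is: $A_{i,i}(x)=A_{i,i}(x)^\top\succ0$ for all $i$ and all $x\in\mathcal X$; the numbers $\kappa_{i,i}=\inf_{x\in\mathcal X}\lambda_{\min}(A_{i,i}(x))$ and $\kappa_{i,j}=\sup_{x\in\mathcal X}\|A_{i,j}(x)\|_2$ ($j\ne i$) are finite; and the matrix $\Upsilon\in\mathbb R^{N\times N}$ with $\Upsilon_{ii}=\kappa_{i,i}$ and $\Upsilon_{ij}=-\kappa_{i,j}$ for $j\neq i$ is a P-matrix (all its principal minors are positive). Then for every $x\in\mathcal X$ and every $i$ the set $B^i(z^i(x))$ is a singleton (and is identified with its element), the game has a unique Nash equilibrium $x^\star$, and for every $x_0\in\mathcal X$ the following hold. 1. The continuous best-response dynamics $\dot x^i(t)=B^i(z^i(x(t)))-x^i(t)$, $i=1,\dots,N$, $x(0)=x_0$, has a unique solution on $[0,\infty)$, and $x(t)\to x^\star$ as $t\to\infty$. 2. The simultaneous discrete best-response dynamics started at $x_0$, namely $x^i_{k+1}=B^i(z^i(x_k))$ for all $i$ and all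 $k\ge0$, determines a unique sequence $(x_k)_{k\ge0}$, and $x_k\to x^\star$. 3. The sequential discrete best-response dynamics started at $x_0$, in which the players update cyclically one at a time (at time $k=Nm+i-1$ with $m\ge0$ and $1\le i\le N$ only player $i$ updates, $x^i_{k+1}=B^i(z^i(x_k))$, and $x^j_{k+1}=x^j_k$ for $j\ne i$), determines a unique sequence $(x_k)_{k\ge0}$, and $x_k\to x^\star$. -/

import Mathlib

open Filter Topology

/-- Strategy profiles `x = [x^1; …; x^N]` of `N` players with strategies in `ℝⁿ`. -/
abbrev Profile (N n : ℕ) : Type := Fin N → EuclideanSpace ℝ (Fin n)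

/-- A network game: a non-negative weighted adjacency matrix `G` with zero diagonal, feasible sets
`X i ⊆ ℝⁿ` and cost functions `J i (x^i, z^i)`, where `z^i` is the neighbour aggregate. -/
structure NetworkGame (N n : ℕ) where
  G : Matrix (Fin N) (Fin N) ℝ
  G_nonneg : ∀ i j, 0 ≤ G i j
  G_diag : ∀ i, G i i = 0
  X : Fin N → Set (EuclideanSpace ℝ (Fin n))
  J : Fin N → EuclideanSpace ℝ (Fin n) → EuclideanSpace ℝ (Fin n) → ℝ

namespace NetworkGame

variable {N n : ℕ} (𝒢 : NetworkGame N n)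

/-- The neighbour aggregate `z^i(x) = ∑ j, G i j x^j`. -/
noncomputable def aggregate (x : Profile N n) (i : Fin N) : EuclideanSpace ℝ (Fin n) :=
  ∑ j, 𝒢.G i j • x j

/-- The set `X = X^1 × … × X^N` of feasible profiles. -/
def feasible : Set (Profile N n) := {x | ∀ i, x i ∈ 𝒢.X i}

/-- The aggregates `z^i(x)` that agent `i` can face when all agents play feasible strategies. -/
def aggregates (i : Fin N) : Set (EuclideanSpace ℝ (Fin n)) :=
  (fun x => 𝒢.aggregate x i) '' 𝒢.feasible

/-- The best response `B^i(z) = argmin_{y ∈ X^i} J^i(y, z)`, as the set of all minimizers. -/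
def bestResponse (i : Fin N) (z : EuclideanSpace ℝ (Fin n)) : Set (EuclideanSpace ℝ (Fin n)) :=
  {y | y ∈ 𝒢.X i ∧ IsMinOn (fun w => 𝒢.J i w z) (𝒢.X i) y}

/-- `x` is a Nash equilibrium. -/
def IsNash (x : Profile N n) : Prop :=
  ∀ i, x i ∈ 𝒢.bestResponse i (𝒢.aggregate x i)

/-- The partial gradient `∇_{x^i} J^i(x^i, z^i)` of the cost of agent `i` in its own strategy. -/
noncomputable def ownGradient (i : Fin N) (y z : EuclideanSpace ℝ (Fin n)) :
    EuclideanSpace ℝ (Fin n) :=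
  gradient (fun w => 𝒢.J i w z) y

/-- The operator `F(x) = [∇_{x^i} J^i(x^i, z^i(x))]_i` (the game Jacobian). -/
noncomputable def F (x : Profile N n) : Profile N n :=
  fun i => 𝒢.ownGradient i (x i) (𝒢.aggregate x i)

end NetworkGame

/-- `f` is twice differentiable at `p`: differentiable near `p`, with derivative differentiable
at `p`. -/
def TwiceDifferentiableAt {E : Type*} [NormedAddCommGroup E] [NormedSpace ℝ E] (f : E → ℝ)
    (p : E) : Prop :=
  (∀ᶠ q in 𝓝 p, DifferentiableAt ℝ f q) ∧ DifferentiableAt ℝ (fderiv ℝ f) p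

/-- The standing assumptions on the strategy sets and on the costs. All the conditions on `J i`
are only imposed at own strategies in `X i` and at aggregates of feasible profiles. -/
structure NetworkGame.Regular {N n : ℕ} (𝒢 : NetworkGame N n) : Prop where
  nonempty : ∀ i, (𝒢.X i).Nonempty
  closed : ∀ i, IsClosed (𝒢.X i)
  convex : ∀ i, Convex ℝ (𝒢.X i)
  differentiable_own : ∀ i, ∀ z ∈ 𝒢.aggregates i, ∀ y ∈ 𝒢.X i,
    DifferentiableAt ℝ (fun w => 𝒢.J i w z) y
  continuous_own : ∀ i, ∀ z ∈ 𝒢.aggregates i,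
    ContinuousOn (fun y => 𝒢.ownGradient i y z) (𝒢.X i)
  convex_own : ∀ i, ∀ z ∈ 𝒢.aggregates i, ConvexOn ℝ (𝒢.X i) (fun y => 𝒢.J i y z)
  twice_differentiable : ∀ i, ∀ p ∈ 𝒢.X i ×ˢ 𝒢.aggregates i,
    TwiceDifferentiableAt (fun q => 𝒢.J i q.1 q.2) p
  lipschitz : ∀ i, ∃ L, LipschitzOnWith L (fun p => 𝒢.ownGradient i p.1 p.2)
    (𝒢.X i ×ˢ 𝒢.aggregates i)

/-- A real square matrix is a P-matrix if all its principal minors are positive. -/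
def IsPMatrix {N : ℕ} (A : Matrix (Fin N) (Fin N) ℝ) : Prop :=
  ∀ s : Finset (Fin N), s.Nonempty →
    0 < (A.submatrix (fun a : s => (a : Fin N)) (fun a : s => (a : Fin N))).det

section UpsilonCondition

variable {N n : ℕ}

/-- The `n × n` block `(i, j)` of an `Nn × Nn` matrix. Matrices are treated as linear maps between
Euclidean spaces, so that the norm of a block is its spectral norm. -/
noncomputable def block (A : Profile N n →L[ℝ] Profile N n) (i j : Fin N) :
    EuclideanSpace ℝ (Fin n) →L[ℝ] EuclideanSpace ℝ (Fin n) :=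
  (ContinuousLinearMap.proj i).comp
    (A.comp (ContinuousLinearMap.single ℝ (fun _ : Fin N => EuclideanSpace ℝ (Fin n)) j))

/-- The smallest eigenvalue (used for symmetric maps only). -/
noncomputable def lambdaMin (T : EuclideanSpace ℝ (Fin n) →L[ℝ] EuclideanSpace ℝ (Fin n)) : ℝ :=
  sInf {μ : ℝ | Module.End.HasEigenvalue
    (T : EuclideanSpace ℝ (Fin n) →ₗ[ℝ] EuclideanSpace ℝ (Fin n)) μ}

/-- `T = Tᵀ ≻ 0`. -/
def IsSymmPosDef (T : EuclideanSpace ℝ (Fin n) →L[ℝ] EuclideanSpace ℝ (Fin n)) : Prop :=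
  (T : EuclideanSpace ℝ (Fin n) →ₗ[ℝ] EuclideanSpace ℝ (Fin n)).IsSymmetric ∧
    ∀ v, v ≠ 0 → 0 < inner ℝ v (T v)

/-- The scalars `κ_{i,i} = inf_{x ∈ X} λ_min(A_{i,i}(x))` and
`κ_{i,j} = sup_{x ∈ X} ‖A_{i,j}(x)‖₂` for `i ≠ j`. -/
noncomputable def kappa (X : Set (Profile N n)) (A : Profile N n → Profile N n →L[ℝ] Profile N n)
    (i j : Fin N) : ℝ :=
  if i = j then sInf ((fun x => lambdaMin (block (A x) i i)) '' X)
  else sSup ((fun x => ‖block (A x) i j‖) '' X)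

/-- The matrix `Υ`, with diagonal entries `κ_{i,i}` and off-diagonal entries `-κ_{i,j}`. -/
noncomputable def upsilon (X : Set (Profile N n))
    (A : Profile N n → Profile N n →L[ℝ] Profile N n) : Matrix (Fin N) (Fin N) ℝ :=
  Matrix.of fun i j => if i = j then kappa X A i j else -kappa X A i j

/-- The `P_Υ` condition over `X`: the diagonal blocks are symmetric and positive definite on `X`,
the `κ_{i,j}` are finite, and `Υ` is a P-matrix. (For `i = j` finiteness is automatic, since the
eigenvalues of the diagonal blocks are positive.) -/
structure PUpsilon (X : Set (Profile N n)) (A : Profile N n → Profile N n →L[ℝ] Profile N n) :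
    Prop where
  diag_posDef : ∀ x ∈ X, ∀ i, IsSymmPosDef (block (A x) i i)
  finite : ∀ i j, i ≠ j → BddAbove ((fun x => ‖block (A x) i j‖) '' X)
  isPMatrix : IsPMatrix (upsilon X A)

end UpsilonCondition

namespace NetworkGame

variable {N n : ℕ} (𝒢 : NetworkGame N n)

/-- `x : [0, ∞) → ℝ^{Nn}` solves the continuous best-response dynamics `ẋ = B(x) - x` with initial
value `x₀` (only the values `x t` with `t ≥ 0` matter; the derivative at `0` is one-sided). -/
def IsContinuousBR (x₀ : Profile N n) (x : ℝ → Profile N n) : Prop :=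
  x 0 = x₀ ∧ ∀ t, 0 ≤ t → ∀ i, ∃ b ∈ 𝒢.bestResponse i (𝒢.aggregate (x t) i),
    HasDerivWithinAt (fun s => x s i) (b - x t i) (Set.Ici 0) t

/-- `x : ℕ → ℝ^{Nn}` is generated by the discrete best-response dynamics from `x₀`, where agent `i`
updates its strategy exactly at the times in `T i`. -/
def IsDiscreteBR (T : Fin N → Set ℕ) (x₀ : Profile N n) (x : ℕ → Profile N n) : Prop :=
  x 0 = x₀ ∧ ∀ k i,
    (k ∈ T i → x (k + 1) i ∈ 𝒢.bestResponse i (𝒢.aggregate (x k) i)) ∧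
    (k ∉ T i → x (k + 1) i = x k i)

end NetworkGame

/-- Simultaneous updates: every agent updates at every time. -/
def simultaneousTimes (N : ℕ) : Fin N → Set ℕ := fun _ => Set.univ

/-- Sequential updates: the agents, numbered `0, …, N - 1`, update cyclically one after another. -/
def sequentialTimes (N : ℕ) : Fin N → Set ℕ := fun i => {k | ∃ m : ℕ, k = N * m + (i : ℕ)}

/-! Everything rests on one fact: the best-response map contracts some weighted norm max_i ‖x_i‖ /
w_i. The mean value theorem along segments turns the block bounds in Υ into one inequality per
player, ⟨y_i - x_i, F_i(y) - F_i(x)⟩ ≥ ‖y_i - x_i‖ Σ_j Υ_ij ‖y_j - x_j‖. When the i-th entries are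
best responses a and b, the first-order conditions make the left side nonpositive, so κ_ii ‖b - a‖ ≤
Σ_{j≠i} κ_ij ‖y_j - x_j‖ (`bestResponse_estimate`). Since Υ is a P-matrix with nonpositive
off-diagonal entries, Υw > 0 for some w > 0 (`IsPMatrix.exists_pos`); these are the weights, and
strictness leaves room for a factor c < 1.

Banach's theorem yields the equilibrium. In continuous time, Grönwall applied to e^t (x - y) shows
that trajectories approach each other like e^{-(1-c)t}; they exist by a fixed point of the integral
equation (`exists_relaxation_solution`), once the best response is extended to the whole space by
projections. In discrete time the maximum norm tolerates any update order: the error bound shrinks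
by c over each window in which all players update (`tendsto_zero_of_asynchronous_contraction`). -/

/-! ### P-matrices with nonpositive off-diagonal entries -/

/-- A matrix with nonpositive off-diagonal entries and positive principal minors is
semipositive: it maps some positive vector to a positive vector. -/
theorem exists_pos_mulVec_pos_of_minors_pos : ∀ (m : ℕ) (A : Matrix (Fin m) (Fin m) ℝ),
    (∀ (α : Type) [Fintype α] [DecidableEq α] (f : α → Fin m), Function.Injective f →
      0 < (A.submatrix f f).det) →
    (∀ i j, i ≠ j → A i j ≤ 0) →
    ∃ v : Fin m → ℝ, (∀ i, 0 < v i) ∧ ∀ i, 0 < ∑ j, A i j * v j := by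
  intro m
  induction m with
  | zero => exact fun A _ _ => ⟨fun _ => 1, fun i => i.elim0, fun i => i.elim0⟩
  | succ m ih =>
    intro A hP hZ
    have ha : 0 < A 0 0 := by
      have := hP Unit (fun _ => 0) (fun _ _ _ => rfl)
      simpa using this
    -- Induction through the Schur complement of the corner `A 0 0`: its principal minors are those
    -- of `A` containing index 0, divided by `A 0 0`, and its off-diagonal entries only get more
    -- negative.
    obtain ⟨v, hv, hSv⟩ := ih
      (Matrix.of fun i j => A i.succ j.succ - A i.succ 0 * (A 0 0)⁻¹ * A 0 j.succ)
      (by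
        intro α _ _ f hf
        have h := hP (Unit ⊕ α) (Sum.elim (fun _ => 0) (fun a => (f a).succ)) (by
          rintro (a | a) (b | b) hab
          · rfl
          · exact absurd hab (Fin.succ_ne_zero _).symm
          · exact absurd hab (Fin.succ_ne_zero _)
          · simpa using hf (Fin.succ_injective _ hab))
        have hB : A.submatrix (Sum.elim (fun _ : Unit => 0) (fun a => (f a).succ))
            (Sum.elim (fun _ : Unit => 0) (fun a => (f a).succ)) =
            Matrix.fromBlocks (Matrix.diagonal fun _ : Unit => A 0 0)
              (Matrix.of fun _ b => A 0 (f b).succ) (Matrix.of fun b _ => A (f b).succ 0)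
              (Matrix.of fun a b => A (f a).succ (f b).succ) := by
          ext (a | a) (b | b) <;> simp
        let _ : Invertible (fun _ : Unit => A 0 0) :=
          ⟨fun _ => (A 0 0)⁻¹, by ext; simp [ha.ne'], by ext; simp [ha.ne']⟩
        let _ : Invertible (Matrix.diagonal fun _ : Unit => A 0 0) := Matrix.diagonalInvertible _
        rw [hB, Matrix.det_fromBlocks₁₁] at h
        have hinv : ⅟(Matrix.diagonal fun _ : Unit => A 0 0) =
            Matrix.diagonal fun _ : Unit => (A 0 0)⁻¹ := rfl
        rw [hinv, Matrix.det_diagonal] at h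
        simp only [Finset.univ_unique, Finset.prod_singleton] at h
        refine (pos_of_mul_pos_right h ha.le).trans_eq (congrArg Matrix.det ?_)
        ext a b
        simp [Matrix.mul_apply, Matrix.diagonal])
      (by
        intro i j hij
        have h1 := hZ i.succ j.succ (fun h => hij (Fin.succ_injective _ h))
        have h2 := mul_nonneg_of_nonpos_of_nonpos (hZ i.succ 0 (Fin.succ_ne_zero _))
          (hZ 0 j.succ (Fin.succ_ne_zero _).symm)
        have h3 := mul_nonneg h2 (inv_pos.2 ha).le
        simp only [Matrix.of_apply]
        nlinarith)
    -- With first coordinate `s₀`, row 0 of `A` gives exactly 0 and the other rows give the Schur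
    -- complement applied to `v`. Adding a small `ε` makes row 0 positive and keeps the others
    -- positive.
    set s₀ : ℝ := -((A 0 0)⁻¹ * ∑ j, A 0 j.succ * v j) with hs₀
    have hs₀nn : 0 ≤ s₀ := by
      rw [hs₀, neg_nonneg]
      refine mul_nonpos_of_nonneg_of_nonpos (inv_pos.2 ha).le (Finset.sum_nonpos fun j _ => ?_)
      exact mul_nonpos_of_nonpos_of_nonneg (hZ _ _ (Fin.succ_ne_zero _).symm) (hv j).le
    obtain ⟨ε, hε, hεS⟩ : ∃ ε : ℝ, 0 < ε ∧ ∀ i : Fin m, 0 < (∑ j,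
        (A i.succ j.succ - A i.succ 0 * (A 0 0)⁻¹ * A 0 j.succ) * v j) + A i.succ 0 * ε := by
      have hev : ∀ᶠ ε : ℝ in 𝓝[>] 0, ∀ i : Fin m, 0 < (∑ j,
          (A i.succ j.succ - A i.succ 0 * (A 0 0)⁻¹ * A 0 j.succ) * v j) + A i.succ 0 * ε := by
        refine eventually_all.2 fun i => ?_
        have hc : Tendsto (fun ε : ℝ => (∑ j,
          (A i.succ j.succ - A i.succ 0 * (A 0 0)⁻¹ * A 0 j.succ) * v j) + A i.succ 0 * ε)
          (𝓝[>] 0) (𝓝 ((∑ j, (A i.succ j.succ - A i.succ 0 * (A 0 0)⁻¹ * A 0 j.succ) * v j) +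
            A i.succ 0 * 0)) :=
          ((by fun_prop : Continuous fun ε : ℝ => (∑ j,
            (A i.succ j.succ - A i.succ 0 * (A 0 0)⁻¹ * A 0 j.succ) * v j) +
              A i.succ 0 * ε).tendsto 0).mono_left nhdsWithin_le_nhds
        refine hc.eventually (lt_mem_nhds ?_)
        simpa using hSv i
      obtain ⟨ε, h1, h2⟩ := (hev.and self_mem_nhdsWithin).exists
      exact ⟨ε, h2, h1⟩
    refine ⟨Fin.cons (s₀ + ε) v, fun i => ?_, fun i => ?_⟩
    · refine Fin.cases ?_ (fun i => ?_) i
      · simpa using by positivity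
      · simpa using hv i
    · refine Fin.cases ?_ (fun i => ?_) i
      · rw [Fin.sum_univ_succ]
        simp only [Fin.cons_zero, Fin.cons_succ, hs₀]
        field_simp
        nlinarith
      · rw [Fin.sum_univ_succ]
        simp only [Fin.cons_zero, Fin.cons_succ]
        refine (hεS i).trans_eq ?_
        simp only [sub_mul, Finset.sum_sub_distrib, hs₀, mul_assoc, ← Finset.mul_sum]
        ring

/-- Minors along an injection agree with those of its image set, since reindexing rows and columns
together preserves the determinant; the empty minor is 1. -/
theorem IsPMatrix.exists_pos {N : ℕ} {A : Matrix (Fin N) (Fin N) ℝ} (hA : IsPMatrix A)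
    (hZ : ∀ i j, i ≠ j → A i j ≤ 0) :
    ∃ v : Fin N → ℝ, (∀ i, 0 < v i) ∧ ∀ i, 0 < ∑ j, A i j * v j := by
  refine exists_pos_mulVec_pos_of_minors_pos N A (fun α _ _ f hf => ?_) hZ
  rcases isEmpty_or_nonempty α with h | h
  · simp
  · have h := hA (Finset.univ.image f) (Finset.univ_nonempty.image f)
    let e : α ≃ (Finset.univ.image f : Finset (Fin N)) :=
      Equiv.ofBijective (fun a => ⟨f a, by simp⟩) ⟨fun a b hab => hf (by simpa using hab),
        fun ⟨b, hb⟩ => by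
          obtain ⟨a, -, rfl⟩ := Finset.mem_image.1 hb
          exact ⟨a, rfl⟩⟩
    rw [← Matrix.det_submatrix_equiv_self e] at h
    exact h

theorem IsPMatrix.diag_pos {N : ℕ} {A : Matrix (Fin N) (Fin N) ℝ} (hA : IsPMatrix A)
    (i : Fin N) : 0 < A i i := by
  have h := hA {i} (Finset.singleton_nonempty i)
  rw [Matrix.det_eq_elem_of_card_eq_one (by simp) ⟨i, Finset.mem_singleton_self i⟩] at h
  exact h

/-! ### Positive definite blocks and the derivative of the game Jacobian -/

theorem IsSymmPosDef.lambdaMin_nonneg {n : ℕ}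
    {T : EuclideanSpace ℝ (Fin n) →L[ℝ] EuclideanSpace ℝ (Fin n)} (hT : IsSymmPosDef T) :
    (∀ μ : ℝ, Module.End.HasEigenvalue
      (T : EuclideanSpace ℝ (Fin n) →ₗ[ℝ] EuclideanSpace ℝ (Fin n)) μ → 0 ≤ μ) ∧
    0 ≤ lambdaMin T := by
  have h : ∀ μ : ℝ, Module.End.HasEigenvalue
      (T : EuclideanSpace ℝ (Fin n) →ₗ[ℝ] EuclideanSpace ℝ (Fin n)) μ → 0 ≤ μ := by
    intro μ hμ
    obtain ⟨v, hv⟩ := hμ.exists_hasEigenvector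
    have h1 : T v = μ • v := hv.apply_eq_smul
    have h2 := hT.2 v hv.2
    rw [h1, inner_smul_right, real_inner_self_eq_norm_sq] at h2
    have h3 : 0 < ‖v‖ ^ 2 := by have := norm_pos_iff.2 hv.2; positivity
    exact (pos_of_mul_pos_left h2 h3.le).le
  exact ⟨h, Real.sInf_nonneg h⟩

/-- The smallest eigenvalue of a positive definite map bounds its quadratic form from below. -/
theorem IsSymmPosDef.lambdaMin_mul_le_inner {n : ℕ}
    {T : EuclideanSpace ℝ (Fin n) →L[ℝ] EuclideanSpace ℝ (Fin n)} (hT : IsSymmPosDef T)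
    (v : EuclideanSpace ℝ (Fin n)) : lambdaMin T * ‖v‖ ^ 2 ≤ inner ℝ v (T v) := by
  rcases eq_or_ne v 0 with rfl | hv
  · simp
  have : Nontrivial (EuclideanSpace ℝ (Fin n)) := ⟨v, 0, hv⟩
  -- The infimum of the Rayleigh quotient is itself an eigenvalue, hence at least `lambdaMin T`.
  have he := hT.1.hasEigenvalue_iInf_of_finiteDimensional
  have h1 : lambdaMin T ≤ _ := csInf_le ⟨0, fun μ hμ => hT.lambdaMin_nonneg.1 μ hμ⟩ he
  have hv2 : 0 < ‖v‖ ^ 2 := by have := norm_pos_iff.2 hv; positivity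
  rw [← le_div_iff₀ hv2]
  refine h1.trans ?_
  refine (ciInf_le ⟨0, ?_⟩ (⟨v, hv⟩ : {x : EuclideanSpace ℝ (Fin n) // x ≠ 0})).trans_eq ?_
  · rintro _ ⟨u, rfl⟩
    have := hT.2 u u.2
    rw [real_inner_comm] at this
    exact div_nonneg this.le (by positivity)
  · simp [real_inner_comm]

/-- Near `p` the partial derivative is the full derivative restricted to the first factor; this uses
differentiability on a neighbourhood of `p`. -/
theorem TwiceDifferentiableAt.differentiableAt_fderiv_left {E G : Type*}
    [NormedAddCommGroup E] [NormedSpace ℝ E] [NormedAddCommGroup G] [NormedSpace ℝ G]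
    {f : E × G → ℝ} {p : E × G} (hf : TwiceDifferentiableAt f p) :
    DifferentiableAt ℝ (fun q : E × G => fderiv ℝ (fun w => f (w, q.2)) q.1) p := by
  have h : (fun q : E × G => fderiv ℝ (fun w => f (w, q.2)) q.1) =ᶠ[𝓝 p]
      fun q => (fderiv ℝ f q).comp (ContinuousLinearMap.inl ℝ E G) := by
    filter_upwards [hf.1] with q hq
    have h1 : HasFDerivAt (fun w : E => (w, q.2)) (ContinuousLinearMap.inl ℝ E G) q.1 :=
      hasFDerivAt_prodMk_left q.1 q.2
    exact (HasFDerivAt.comp q.1 (hq.hasFDerivAt : HasFDerivAt f _ (q.1, q.2)) h1).fderiv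
  exact (hf.2.clm_comp (differentiableAt_const _)).congr_of_eventuallyEq h

namespace NetworkGame

variable {N n : ℕ} {𝒢 : NetworkGame N n}

theorem aggregate_mem_aggregates {x : Profile N n} (hx : x ∈ 𝒢.feasible) (i : Fin N) :
    𝒢.aggregate x i ∈ 𝒢.aggregates i := ⟨x, hx, rfl⟩

/-- The zero diagonal of `G` enters here: changing one's own strategy leaves one's own aggregate
fixed. -/
theorem aggregate_update (x : Profile N n) (i : Fin N) (y : EuclideanSpace ℝ (Fin n)) :
    𝒢.aggregate (Function.update x i y) i = 𝒢.aggregate x i := by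
  refine Finset.sum_congr rfl fun j _ => ?_
  rcases eq_or_ne j i with rfl | h
  · simp [𝒢.G_diag]
  · simp [h]

theorem update_mem_feasible {x : Profile N n} (hx : x ∈ 𝒢.feasible) {i : Fin N}
    {y : EuclideanSpace ℝ (Fin n)} (hy : y ∈ 𝒢.X i) :
    Function.update x i y ∈ 𝒢.feasible := by
  intro j
  rcases eq_or_ne j i with rfl | h
  · simpa using hy
  · simpa [h] using hx j

theorem F_update (x : Profile N n) (i : Fin N) (y : EuclideanSpace ℝ (Fin n)) :
    𝒢.F (Function.update x i y) i = 𝒢.ownGradient i y (𝒢.aggregate x i) := by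
  simp [F, aggregate_update]

theorem Regular.convex_feasible (hreg : 𝒢.Regular) : Convex ℝ 𝒢.feasible :=
  fun _ hx _ hy _ _ ha hb hab i => hreg.convex i (hx i) (hy i) ha hb hab

theorem Regular.differentiableAt_F (hreg : 𝒢.Regular) {x : Profile N n} (hx : x ∈ 𝒢.feasible) :
    DifferentiableAt ℝ 𝒢.F x := by
  refine differentiableAt_pi.2 fun i => ?_
  have h := (hreg.twice_differentiable i (x i, 𝒢.aggregate x i)
    ⟨hx i, aggregate_mem_aggregates hx i⟩).differentiableAt_fderiv_left
  have hagg : DifferentiableAt ℝ (fun y : Profile N n => (y i, 𝒢.aggregate y i)) x := by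
    unfold aggregate
    fun_prop
  have h2 := DifferentiableAt.comp x h hagg
  exact (InnerProductSpace.toDual ℝ (EuclideanSpace ℝ (Fin n))).symm.toContinuousLinearEquiv.toContinuousLinearMap.differentiableAt.comp x h2

end NetworkGame

theorem apply_eq_sum_block {N n : ℕ} (A : Profile N n →L[ℝ] Profile N n) (d : Profile N n)
    (i : Fin N) : A d i = ∑ j, block A i j (d j) := by
  conv_lhs => rw [← Finset.univ_sum_single d, map_sum, Finset.sum_apply]
  rfl

namespace PUpsilon

variable {N n : ℕ} {X : Set (Profile N n)} {A : Profile N n → Profile N n →L[ℝ] Profile N n}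

/-- The diagonal block is bounded by its smallest eigenvalue, the others by Cauchy–Schwarz. Keeping
`i` fixed instead of summing is what lets the P-matrix property suffice. -/
theorem upsilon_mul_le_inner (hΥ : PUpsilon X A) {x : Profile N n} (hx : x ∈ X)
    (d : Profile N n) (i : Fin N) :
    (∑ j, upsilon X A i j * ‖d j‖) * ‖d i‖ ≤ inner ℝ (d i) (A x d i) := by
  rw [apply_eq_sum_block, inner_sum, Finset.sum_mul]
  refine Finset.sum_le_sum fun j _ => ?_
  rcases eq_or_ne i j with rfl | h
  · simp only [upsilon, Matrix.of_apply, if_true, kappa]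
    refine le_trans ?_ ((hΥ.diag_posDef x hx i).lambdaMin_mul_le_inner (d i))
    rw [mul_assoc, ← sq]
    refine mul_le_mul_of_nonneg_right (csInf_le ⟨0, ?_⟩ ⟨x, hx, rfl⟩) (sq_nonneg _)
    rintro _ ⟨y, hy, rfl⟩
    exact (hΥ.diag_posDef y hy i).lambdaMin_nonneg.2
  · simp only [upsilon, Matrix.of_apply, if_neg h, kappa]
    have h1 : ‖block (A x) i j‖ ≤ sSup ((fun x => ‖block (A x) i j‖) '' X) :=
      le_csSup (hΥ.finite i j h) ⟨x, hx, rfl⟩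
    have h2 := abs_real_inner_le_norm (d i) (block (A x) i j (d j))
    have h3 := (block (A x) i j).le_opNorm (d j)
    have h4 : ‖block (A x) i j (d j)‖ ≤ sSup ((fun x => ‖block (A x) i j‖) '' X) * ‖d j‖ :=
      h3.trans (mul_le_mul_of_nonneg_right h1 (norm_nonneg _))
    have h5 := mul_le_mul_of_nonneg_left h4 (norm_nonneg (d i))
    have h6 := neg_le_of_abs_le (h2.trans h5)
    linarith

theorem upsilon_nonpos (i j : Fin N) (h : i ≠ j) : upsilon X A i j ≤ 0 := by
  simp only [upsilon, Matrix.of_apply, if_neg h, kappa, neg_nonpos]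
  refine Real.sSup_nonneg ?_
  rintro _ ⟨x, -, rfl⟩
  exact norm_nonneg _

end PUpsilon

/-! ### Monotonicity, strong convexity and best responses -/

namespace NetworkGame

variable {N n : ℕ} {𝒢 : NetworkGame N n}

/-- Componentwise monotonicity estimate for the game Jacobian. -/
theorem Regular.upsilon_mul_le_inner (hreg : 𝒢.Regular)
    (hΥ : PUpsilon 𝒢.feasible (fun x => fderiv ℝ 𝒢.F x)) {x y : Profile N n}
    (hx : x ∈ 𝒢.feasible) (hy : y ∈ 𝒢.feasible) (i : Fin N) :
    (∑ j, upsilon 𝒢.feasible (fun x => fderiv ℝ 𝒢.F x) i j * ‖y j - x j‖) * ‖y i - x i‖ ≤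
      inner ℝ (y i - x i) (𝒢.F y i - 𝒢.F x i) := by
  have hmem : ∀ t ∈ Set.Icc (0 : ℝ) 1, x + t • (y - x) ∈ 𝒢.feasible := fun t ht =>
    hreg.convex_feasible.add_smul_sub_mem hx hy ht
  have hd : ∀ t ∈ Set.Icc (0 : ℝ) 1,
      HasDerivAt (fun t : ℝ => inner ℝ (y i - x i) (𝒢.F (x + t • (y - x)) i))
        (inner ℝ (y i - x i) (fderiv ℝ 𝒢.F (x + t • (y - x)) (y - x) i)) t := by
    intro t ht
    have h1 : HasDerivAt (fun t : ℝ => x + t • (y - x)) (y - x) t := by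
      simpa using ((hasDerivAt_id t).smul_const (y - x)).const_add x
    have h2 := (hreg.differentiableAt_F (hmem t ht)).hasFDerivAt.comp_hasDerivAt t h1
    have h3 := hasDerivAt_pi.1 h2 i
    exact (innerSL ℝ (y i - x i)).hasFDerivAt.comp_hasDerivAt t h3
  -- The scalar mean value theorem needs no continuity of the derivative of `F`. The point `t`
  -- depends on `i`, which is harmless because Υ bounds the blocks uniformly.
  obtain ⟨t, ht, hs⟩ := exists_hasDerivAt_eq_slope _ _ (zero_lt_one' ℝ)
    (fun t ht => (hd t ht).continuousAt.continuousWithinAt)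
    (fun t ht => hd t (Set.Ioo_subset_Icc_self ht))
  have h := hΥ.upsilon_mul_le_inner (hmem t (Set.Ioo_subset_Icc_self ht)) (y - x) i
  simp only [Pi.sub_apply] at h
  rw [hs] at h
  simpa [inner_sub_right] using h

theorem Regular.ownGradient_mono (hreg : 𝒢.Regular)
    (hΥ : PUpsilon 𝒢.feasible (fun x => fderiv ℝ 𝒢.F x)) {x : Profile N n}
    (hx : x ∈ 𝒢.feasible) (i : Fin N) {a b : EuclideanSpace ℝ (Fin n)}
    (ha : a ∈ 𝒢.X i) (hb : b ∈ 𝒢.X i) :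
    upsilon 𝒢.feasible (fun x => fderiv ℝ 𝒢.F x) i i * ‖b - a‖ ^ 2 ≤
      inner ℝ (b - a) (𝒢.ownGradient i b (𝒢.aggregate x i) -
        𝒢.ownGradient i a (𝒢.aggregate x i)) := by
  have h := hreg.upsilon_mul_le_inner hΥ (update_mem_feasible hx ha) (update_mem_feasible hx hb) i
  rw [F_update, F_update, Finset.sum_eq_single i] at h
  · simpa [mul_assoc, sq] using h
  · intro j _ hj
    simp [hj]
  · simp

/-- Strong convexity of the cost of a player in its own strategy. -/
theorem Regular.strong_convexity (hreg : 𝒢.Regular)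
    (hΥ : PUpsilon 𝒢.feasible (fun x => fderiv ℝ 𝒢.F x)) {x : Profile N n}
    (hx : x ∈ 𝒢.feasible) (i : Fin N) {a b : EuclideanSpace ℝ (Fin n)}
    (ha : a ∈ 𝒢.X i) (hb : b ∈ 𝒢.X i) :
    𝒢.J i a (𝒢.aggregate x i) + inner ℝ (b - a) (𝒢.ownGradient i a (𝒢.aggregate x i)) +
      upsilon 𝒢.feasible (fun x => fderiv ℝ 𝒢.F x) i i / 2 * ‖b - a‖ ^ 2 ≤
      𝒢.J i b (𝒢.aggregate x i) := by
  set κ := upsilon 𝒢.feasible (fun x => fderiv ℝ 𝒢.F x) i i with hκ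
  set z := 𝒢.aggregate x i with hz
  have hmem : ∀ t ∈ Set.Icc (0 : ℝ) 1, a + t • (b - a) ∈ 𝒢.X i := fun t ht =>
    (hreg.convex i).add_smul_sub_mem ha hb ht
  -- The cost along the segment, minus its tangent at `a` and the quadratic term, is monotone in
  -- `t`; its endpoint values give the claim.
  have hd : ∀ t ∈ Set.Icc (0 : ℝ) 1,
      HasDerivAt (fun t : ℝ => 𝒢.J i (a + t • (b - a)) z -
        t * inner ℝ (b - a) (𝒢.ownGradient i a z) - κ / 2 * ‖b - a‖ ^ 2 * t ^ 2)
        (inner ℝ (b - a) (𝒢.ownGradient i (a + t • (b - a)) z - 𝒢.ownGradient i a z) -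
          κ * ‖b - a‖ ^ 2 * t) t := by
    intro t ht
    have h1 : HasDerivAt (fun t : ℝ => a + t • (b - a)) (b - a) t := by
      simpa using ((hasDerivAt_id t).smul_const (b - a)).const_add a
    have h2 := (hreg.differentiable_own i z (aggregate_mem_aggregates hx i) _
      (hmem t ht)).hasGradientAt.hasFDerivAt.comp_hasDerivAt t h1
    have h3 := (h2.sub ((hasDerivAt_id t).mul_const
      (inner ℝ (b - a) (𝒢.ownGradient i a z)))).sub
      (((hasDerivAt_id t).pow 2).const_mul (κ / 2 * ‖b - a‖ ^ 2))
    refine h3.congr_deriv ?_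
    rw [InnerProductSpace.toDual_apply_apply, real_inner_comm (b - a) (gradient _ _)]
    simp only [inner_sub_right (b - a), ownGradient, id]
    push_cast
    ring
  have hmono := monotoneOn_of_deriv_nonneg (convex_Icc (0 : ℝ) 1)
    (fun t ht => (hd t ht).continuousAt.continuousWithinAt)
    (fun t ht => (hd t (interior_subset ht)).differentiableAt.differentiableWithinAt)
    (fun t ht => by
      rw [interior_Icc] at ht
      rw [(hd t (Set.Ioo_subset_Icc_self ht)).deriv]
      have h := hreg.ownGradient_mono hΥ hx i ha (hmem t (Set.Ioo_subset_Icc_self ht))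
      rw [← hκ, ← hz, add_sub_cancel_left, norm_smul, real_inner_smul_left, mul_pow,
        Real.norm_eq_abs, sq_abs] at h
      rw [show κ * (t ^ 2 * ‖b - a‖ ^ 2) = t * (κ * ‖b - a‖ ^ 2 * t) by ring] at h
      exact sub_nonneg.2 (le_of_mul_le_mul_left h ht.1))
  have h := hmono (Set.left_mem_Icc.2 zero_le_one) (Set.right_mem_Icc.2 zero_le_one) zero_le_one
  simp only [zero_smul, one_smul, add_zero, add_sub_cancel] at h
  linarith

/-- First order optimality condition for a best response. -/
theorem Regular.inner_nonneg_of_mem_bestResponse (hreg : 𝒢.Regular) {x : Profile N n}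
    (hx : x ∈ 𝒢.feasible) {i : Fin N} {a b : EuclideanSpace ℝ (Fin n)}
    (ha : a ∈ 𝒢.bestResponse i (𝒢.aggregate x i)) (hb : b ∈ 𝒢.X i) :
    0 ≤ inner ℝ (b - a) (𝒢.ownGradient i a (𝒢.aggregate x i)) := by
  have h := (hreg.differentiable_own i _ (aggregate_mem_aggregates hx i) a
    ha.1).hasGradientAt.hasFDerivAt.hasFDerivWithinAt (s := 𝒢.X i)
  have h2 := ha.2.localize.hasFDerivWithinAt_nonneg h
    (sub_mem_posTangentConeAt_of_segment_subset ((hreg.convex i).segment_subset ha.1 hb))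
  rw [InnerProductSpace.toDual_apply_apply, real_inner_comm] at h2
  exact h2

/-- Strong convexity gives coercivity: once ‖b - a‖ ≥ 2‖g‖/κ, the quadratic term absorbs the linear
one and the cost at `b` is no less than at `a`. -/
theorem Regular.bestResponse_nonempty (hreg : 𝒢.Regular)
    (hΥ : PUpsilon 𝒢.feasible (fun x => fderiv ℝ 𝒢.F x)) {x : Profile N n}
    (hx : x ∈ 𝒢.feasible) (i : Fin N) : (𝒢.bestResponse i (𝒢.aggregate x i)).Nonempty := by
  obtain ⟨a, ha⟩ := hreg.nonempty i
  have hκ := hΥ.isPMatrix.diag_pos i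
  set κ := upsilon 𝒢.feasible (fun x => fderiv ℝ 𝒢.F x) i i
  set g := 𝒢.ownGradient i a (𝒢.aggregate x i) with hg
  have hc : ContinuousOn (fun w => 𝒢.J i w (𝒢.aggregate x i)) (𝒢.X i) := fun y hy =>
    (hreg.differentiable_own i _ (aggregate_mem_aggregates hx i) y
      hy).continuousAt.continuousWithinAt
  obtain ⟨b, hb, hmin⟩ := hc.exists_isMinOn' (hreg.closed i) ha (by
    rw [eventually_inf_principal]
    filter_upwards [(tendsto_norm_cocompact_atTop
      (E := EuclideanSpace ℝ (Fin n))).eventually_ge_atTop (2 * ‖g‖ / κ + ‖a‖)] with b hb hbX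
    have h1 := hreg.strong_convexity hΥ hx i ha hbX
    have h2 : 2 * ‖g‖ / κ ≤ ‖b - a‖ := by linarith [norm_sub_norm_le b a]
    rw [div_le_iff₀ hκ] at h2
    have h3 := neg_le_of_abs_le (abs_real_inner_le_norm (b - a) g)
    have h4 := mul_le_mul_of_nonneg_left h2 (norm_nonneg (b - a))
    have h5 : κ / 2 * ‖b - a‖ ^ 2 = ‖b - a‖ * (‖b - a‖ * κ) / 2 := by ring
    linarith)
  exact ⟨b, hb, hmin⟩

/-- Block-wise contraction estimate for the best responses. -/
theorem Regular.bestResponse_estimate (hreg : 𝒢.Regular)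
    (hΥ : PUpsilon 𝒢.feasible (fun x => fderiv ℝ 𝒢.F x)) {x y : Profile N n}
    (hx : x ∈ 𝒢.feasible) (hy : y ∈ 𝒢.feasible) {i : Fin N} {a b : EuclideanSpace ℝ (Fin n)}
    (ha : a ∈ 𝒢.bestResponse i (𝒢.aggregate x i))
    (hb : b ∈ 𝒢.bestResponse i (𝒢.aggregate y i)) :
    upsilon 𝒢.feasible (fun x => fderiv ℝ 𝒢.F x) i i * ‖b - a‖ ≤
      ∑ j ∈ Finset.univ.erase i,
        -upsilon 𝒢.feasible (fun x => fderiv ℝ 𝒢.F x) i j * ‖y j - x j‖ := by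
  set U := upsilon 𝒢.feasible (fun x => fderiv ℝ 𝒢.F x)
  have hS : 0 ≤ ∑ j ∈ Finset.univ.erase i, -U i j * ‖y j - x j‖ :=
    Finset.sum_nonneg fun j hj => mul_nonneg
      (neg_nonneg.2 (PUpsilon.upsilon_nonpos i j (Finset.ne_of_mem_erase hj).symm)) (norm_nonneg _)
  rcases eq_or_ne b a with rfl | hne
  · simpa using hS
  -- Inserting the best responses does not change the aggregates player `i` faces, so `F` at these
  -- profiles has the gradients from the optimality conditions as its i-th entries.
  have h := hreg.upsilon_mul_le_inner hΥ (update_mem_feasible hx ha.1)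
    (update_mem_feasible hy hb.1) i
  rw [F_update, F_update, ← Finset.add_sum_erase _ _ (Finset.mem_univ i)] at h
  have hs : ∑ j ∈ Finset.univ.erase i,
      U i j * ‖Function.update y i b j - Function.update x i a j‖ =
      -∑ j ∈ Finset.univ.erase i, -U i j * ‖y j - x j‖ := by
    rw [← Finset.sum_neg_distrib]
    refine Finset.sum_congr rfl fun j hj => ?_
    simp [Finset.ne_of_mem_erase hj]
  rw [hs] at h
  simp only [Function.update_self] at h
  -- Each optimality condition is tested at the other best response; together they make the right
  -- side of `h` nonpositive.
  have h1 := hreg.inner_nonneg_of_mem_bestResponse hx ha hb.1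
  have h2 := hreg.inner_nonneg_of_mem_bestResponse hy hb ha.1
  rw [← neg_sub b a, inner_neg_left] at h2
  rw [inner_sub_right] at h
  have h3 := nonpos_of_mul_nonpos_left (h.trans (by linarith))
    (norm_pos_iff.2 (sub_ne_zero.2 hne))
  linarith

end NetworkGame

/-! ### Contraction in a weighted maximum norm -/

/-- A weighted maximum norm in which an off-diagonal nonnegative matrix is a contraction. -/
theorem PUpsilon.exists_weights {N n : ℕ} {X : Set (Profile N n)}
    {A : Profile N n → Profile N n →L[ℝ] Profile N n} (hΥ : PUpsilon X A) :
    ∃ (w : Fin N → ℝ) (c : ℝ), (∀ i, 0 < w i) ∧ 0 ≤ c ∧ c < 1 ∧ ∀ i,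
      ∑ j ∈ Finset.univ.erase i, -upsilon X A i j * w j ≤ upsilon X A i i * (c * w i) := by
  obtain ⟨w, hw, h⟩ := hΥ.isPMatrix.exists_pos PUpsilon.upsilon_nonpos
  have hd := hΥ.isPMatrix.diag_pos
  -- At `c = 1` these are the rows of Υw > 0, finitely many strict inequalities, so they survive for
  -- `c` slightly below 1.
  have hev : ∀ᶠ c : ℝ in 𝓝[<] 1, ∀ i,
      ∑ j ∈ Finset.univ.erase i, -upsilon X A i j * w j ≤ upsilon X A i i * (c * w i) := by
    refine eventually_all.2 fun i => ?_
    have hc : Tendsto (fun c : ℝ => upsilon X A i i * (c * w i)) (𝓝[<] 1)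
        (𝓝 (upsilon X A i i * (1 * w i))) :=
      ((by fun_prop : Continuous fun c : ℝ => upsilon X A i i * (c * w i)).tendsto 1).mono_left
        nhdsWithin_le_nhds
    refine hc.eventually_const_le ?_
    have := h i
    rw [← Finset.add_sum_erase _ _ (Finset.mem_univ i)] at this
    simp only [neg_mul, Finset.sum_neg_distrib]
    linarith
  obtain ⟨c, h1, h2⟩ := (hev.and (Ico_mem_nhdsLT (zero_lt_one' ℝ))).exists
  exact ⟨w, c, hw, h2.1, h2.2, h1⟩

/-- The best-response map is a contraction in a weighted maximum norm. -/
theorem NetworkGame.Regular.exists_contraction {N n : ℕ} {𝒢 : NetworkGame N n}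
    (hreg : 𝒢.Regular) (hΥ : PUpsilon 𝒢.feasible (fun x => fderiv ℝ 𝒢.F x)) :
    ∃ (w : Fin N → ℝ) (c : ℝ), (∀ i, 0 < w i) ∧ 0 ≤ c ∧ c < 1 ∧
      ∀ x ∈ 𝒢.feasible, ∀ y ∈ 𝒢.feasible, ∀ D, (∀ j, ‖y j - x j‖ ≤ w j * D) → ∀ i,
      ∀ a ∈ 𝒢.bestResponse i (𝒢.aggregate x i), ∀ b ∈ 𝒢.bestResponse i (𝒢.aggregate y i),
      ‖b - a‖ ≤ c * w i * D := by
  obtain ⟨w, c, hw, hc0, hc1, h⟩ := hΥ.exists_weights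
  refine ⟨w, c, hw, hc0, hc1, fun x hx y hy D hD i a ha b hb => ?_⟩
  have hD0 : 0 ≤ D := nonneg_of_mul_nonneg_right ((norm_nonneg _).trans (hD i)) (hw i)
  have h1 := hreg.bestResponse_estimate hΥ hx hy ha hb
  refine le_of_mul_le_mul_left (h1.trans ?_) (hΥ.isPMatrix.diag_pos i)
  rw [← mul_assoc]
  refine le_trans ?_ (mul_le_mul_of_nonneg_right (h i) hD0)
  rw [Finset.sum_mul]
  refine Finset.sum_le_sum fun j hj => ?_
  rw [mul_assoc]
  exact mul_le_mul_of_nonneg_left (hD j)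
    (neg_nonneg.2 (PUpsilon.upsilon_nonpos i j (Finset.ne_of_mem_erase hj).symm))

/-! ### Projections and relaxation dynamics -/

/-- The metric projection onto a closed convex set. -/
theorem exists_nonexpansive_retraction {E : Type*} [NormedAddCommGroup E] [InnerProductSpace ℝ E]
    [CompleteSpace E] {K : Set E} (hne : K.Nonempty) (hcl : IsClosed K) (hconv : Convex ℝ K) :
    ∃ P : E → E, (∀ x, P x ∈ K) ∧ (∀ x ∈ K, P x = x) ∧ ∀ x y, ‖P x - P y‖ ≤ ‖x - y‖ := by
  choose P hP hmin using exists_norm_eq_iInf_of_complete_convex hne hcl.isComplete hconv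
  have hvi : ∀ x, ∀ y ∈ K, inner ℝ (x - P x) (y - P x) ≤ 0 := fun x =>
    (norm_eq_iInf_iff_real_inner_le_zero hconv (hP x)).1 (hmin x)
  refine ⟨P, hP, fun x hx => ?_, fun x y => ?_⟩
  · have h := hvi x x hx
    rw [real_inner_self_eq_norm_sq] at h
    have h0 : ‖x - P x‖ = 0 := by nlinarith [norm_nonneg (x - P x)]
    exact (sub_eq_zero.1 (norm_eq_zero.1 h0)).symm
  · have h1 := hvi x (P y) (hP y)
    have h2 := hvi y (P x) (hP x)
    have h3 : inner ℝ (x - y) (P x - P y) = ‖P x - P y‖ ^ 2 -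
        inner ℝ (x - P x) (P y - P x) - inner ℝ (y - P y) (P x - P y) := by
      rw [← real_inner_self_eq_norm_sq]
      simp only [inner_sub_left, inner_sub_right]
      ring
    have h4 := real_inner_le_norm (x - y) (P x - P y)
    rcases (norm_nonneg (P x - P y)).eq_or_lt with h0 | h0
    · rw [← h0]
      exact norm_nonneg _
    · refine le_of_mul_le_mul_right (a := ‖P x - P y‖) ?_ h0
      nlinarith

/-- A closed convex set is invariant under relaxation towards its points. -/
theorem mem_of_relaxation {E : Type*} [NormedAddCommGroup E] [NormedSpace ℝ E] {K : Set E}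
    (hcl : IsClosed K) (hconv : Convex ℝ K) {x : ℝ → E} (h0 : x 0 ∈ K)
    (hx : ∀ t, 0 ≤ t → ∃ b ∈ K, HasDerivWithinAt x (b - x t) (Set.Ici 0) t) {t : ℝ}
    (ht : 0 ≤ t) : x t ∈ K := by
  by_contra hxt
  obtain ⟨l, M, hlM, hMx⟩ := geometric_hahn_banach_closed_point hconv hcl hxt
  choose! b hb hd using hx
  -- The factor e^s cancels the drift -x, so this function decreases wherever the target lies on the
  -- side of `K`; it starts negative and cannot be positive at `t`.
  have hder : ∀ s, 0 ≤ s → HasDerivWithinAt (fun s => Real.exp s * (l (x s) - M))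
      (Real.exp s * (l (b s) - M)) (Set.Ici 0) s := by
    intro s hs
    have h1 := (l.hasFDerivAt.comp_hasDerivWithinAt s (hd s hs)).sub_const M
    refine ((Real.hasDerivAt_exp s).hasDerivWithinAt.mul h1).congr_deriv ?_
    simp only [Function.comp_apply, map_sub]
    ring
  have hanti : AntitoneOn (fun s => Real.exp s * (l (x s) - M)) (Set.Ici 0) := by
    refine antitoneOn_of_deriv_nonpos (convex_Ici 0)
      (fun s hs => (hder s hs).continuousWithinAt) (fun s hs => ?_) (fun s hs => ?_)
    · exact ((hder s (interior_subset hs)).mono interior_subset).differentiableWithinAt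
    · have hs0 := interior_subset hs
      rw [((hder s hs0).hasDerivAt (mem_interior_iff_mem_nhds.1 hs)).deriv]
      exact mul_nonpos_of_nonneg_of_nonpos (Real.exp_pos s).le
        (sub_nonpos.2 (hlM _ (hb s hs0)).le)
  have h := hanti (Set.mem_Ici.2 le_rfl) (Set.mem_Ici.2 ht) ht
  have h1 := hlM _ h0
  have h2 := mul_pos (Real.exp_pos t) (sub_pos.2 hMx)
  simp only [Real.exp_zero, one_mul] at h
  linarith

/-- Relaxation dynamics towards contracting targets approach each other exponentially. -/
theorem norm_sub_le_of_relaxation {V : Type*} [NormedAddCommGroup V] [NormedSpace ℝ V]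
    {c : ℝ} {x y p q : ℝ → V}
    (hx : ∀ t, 0 ≤ t → HasDerivWithinAt x (p t - x t) (Set.Ici 0) t)
    (hy : ∀ t, 0 ≤ t → HasDerivWithinAt y (q t - y t) (Set.Ici 0) t)
    (hpq : ∀ t, 0 ≤ t → ‖p t - q t‖ ≤ c * ‖x t - y t‖) {t : ℝ} (ht : 0 ≤ t) :
    ‖x t - y t‖ ≤ ‖x 0 - y 0‖ * Real.exp (-((1 - c) * t)) := by
  have hd : ∀ s, 0 ≤ s → HasDerivWithinAt (fun s => Real.exp s • (x s - y s))
      (Real.exp s • (p s - q s)) (Set.Ici 0) s := by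
    intro s hs
    refine ((Real.hasDerivAt_exp s).hasDerivWithinAt.smul ((hx s hs).sub (hy s hs))).congr_deriv ?_
    simp only [Pi.sub_apply]
    module
  have h := norm_le_gronwallBound_of_norm_deriv_right_le (K := c) (ε := 0) (a := 0) (b := t)
    (fun s hs => (hd s hs.1).continuousWithinAt.mono Set.Icc_subset_Ici_self)
    (fun s hs => (hd s hs.1).mono (Set.Ici_subset_Ici.2 hs.1)) le_rfl
    (fun s hs => by
      rw [norm_smul, norm_smul, add_zero, mul_left_comm]
      exact mul_le_mul_of_nonneg_left (hpq s hs.1) (norm_nonneg _)) t ⟨ht, le_rfl⟩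
  rw [gronwallBound_ε0, norm_smul, norm_smul, Real.norm_eq_abs, Real.norm_eq_abs, Real.abs_exp,
    Real.abs_exp, Real.exp_zero, one_mul, sub_zero] at h
  rw [show -((1 - c) * t) = c * t - t by ring, Real.exp_sub, ← mul_div_assoc,
    le_div_iff₀ (Real.exp_pos t), mul_comm]
  exact h

/-- Weighted averages `e⁻ᵗ ∫₀ᵗ eˢ g(s) ds` of a bounded function are bounded. -/
theorem norm_exp_neg_smul_integral_le {V : Type*} [NormedAddCommGroup V] [NormedSpace ℝ V]
    {g : ℝ → V} {M : ℝ} (hM : ∀ s, ‖g s‖ ≤ M) {t : ℝ} (ht : 0 ≤ t) :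
    ‖Real.exp (-t) • ∫ s in (0 : ℝ)..t, Real.exp s • g s‖ ≤ M := by
  have hM0 : 0 ≤ M := (norm_nonneg _).trans (hM 0)
  have h : ‖∫ s in (0 : ℝ)..t, Real.exp s • g s‖ ≤ ∫ s in (0 : ℝ)..t, Real.exp s * M := by
    refine intervalIntegral.norm_integral_le_of_norm_le ht (Eventually.of_forall fun s _ => ?_)
      ((by fun_prop : Continuous fun s => Real.exp s * M).intervalIntegrable 0 t)
    rw [norm_smul, Real.norm_eq_abs, Real.abs_exp]
    exact mul_le_mul_of_nonneg_left (hM s) (Real.exp_pos s).le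
  rw [intervalIntegral.integral_mul_const, integral_exp, Real.exp_zero] at h
  rw [norm_smul, Real.norm_eq_abs, Real.abs_exp, Real.exp_neg, inv_mul_le_iff₀ (Real.exp_pos t)]
  nlinarith

/-- Relaxation dynamics `x' = f(x) - x` of a contraction `f` has a global solution. -/
theorem exists_relaxation_solution {V : Type*} [NormedAddCommGroup V] [NormedSpace ℝ V]
    [CompleteSpace V] {c : NNReal} {f : V → V} (hf : ContractingWith c f) (x₀ : V) :
    ∃ x : ℝ → V, x 0 = x₀ ∧
      ∀ t, 0 ≤ t → HasDerivWithinAt x (f (x t) - x t) (Set.Ici 0) t := by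
  -- Variation of constants: solutions are the fixed points of `u ↦ Φ (f ∘ u)`. The kernel e^{s-t}
  -- has mass at most 1 on [0, t], so the map contracts the sup norm with factor `c` on all of [0,
  -- ∞) at once.
  let Φ : (ℝ → V) → ℝ → V := fun g t =>
    Real.exp (-t) • (x₀ + ∫ s in (0 : ℝ)..t, Real.exp s • g s)
  have hderiv : ∀ g : ℝ → V, Continuous g → ∀ t, HasDerivAt (Φ g) (g t - Φ g t) t := by
    intro g hg t
    have hc : Continuous fun s => Real.exp s • g s := by fun_prop
    have h1 := (intervalIntegral.integral_hasDerivAt_right (hc.intervalIntegrable 0 t)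
      (hc.stronglyMeasurableAtFilter _ _) hc.continuousAt).const_add x₀
    have h2 := ((hasDerivAt_neg t).exp).smul h1
    refine h2.congr_deriv ?_
    simp only [Φ, smul_smul, ← Real.exp_add, neg_add_cancel, Real.exp_zero, mul_neg, mul_one]
    module
  -- Freezing negative times with `max t 0` keeps the image bounded on all of ℝ.
  have hT : ∀ u : BoundedContinuousFunction ℝ V, ∃ Tu : BoundedContinuousFunction ℝ V,
      ∀ t, Tu t = Φ (f ∘ u) (max t 0) := by
    intro u
    have hfu : Continuous (f ∘ u) := hf.2.continuous.comp u.continuous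
    have hcont : Continuous (fun t => Φ (f ∘ u) (max t 0)) :=
      (continuous_iff_continuousAt.2 fun t => (hderiv _ hfu t).continuousAt).comp
        (continuous_id.max continuous_const)
    refine ⟨BoundedContinuousFunction.ofNormedAddCommGroup _ hcont
      (‖x₀‖ + (c * ‖u‖ + ‖f 0‖)) fun t => ?_, fun t => rfl⟩
    have ht : 0 ≤ max t 0 := le_max_right _ _
    simp only [Φ, smul_add]
    refine (norm_add_le _ _).trans (add_le_add ?_ (norm_exp_neg_smul_integral_le (fun s => ?_) ht))
    · rw [norm_smul, Real.norm_eq_abs, Real.abs_exp]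
      exact mul_le_of_le_one_left (norm_nonneg _) (Real.exp_le_one_iff.2 (neg_nonpos.2 ht))
    · have h1 := hf.2.norm_sub_le (u s) 0
      rw [sub_zero] at h1
      have h2 := mul_le_mul_of_nonneg_left (u.norm_coe_le_norm s) c.2
      have h3 := norm_le_norm_add_norm_sub' (f (u s)) (f 0)
      simp only [Function.comp_apply]
      simp only [NNReal.val_eq_coe] at h2
      linarith
  choose T hT using hT
  have hTc : ContractingWith c T := by
    refine ⟨hf.1, LipschitzWith.of_dist_le_mul fun u v => ?_⟩
    refine (BoundedContinuousFunction.dist_le (by positivity)).2 fun t => ?_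
    have hint : ∀ u : BoundedContinuousFunction ℝ V, IntervalIntegrable
        (fun s => Real.exp s • (f ∘ u) s) MeasureTheory.volume 0 (max t 0) := fun u =>
      (Real.continuous_exp.smul (hf.2.continuous.comp u.continuous)).intervalIntegrable _ _
    rw [hT, hT, dist_eq_norm, ← smul_sub, add_sub_add_left_eq_sub,
      ← intervalIntegral.integral_sub (hint u) (hint v)]
    simp only [← smul_sub]
    refine norm_exp_neg_smul_integral_le (fun s => ?_) (le_max_right _ _)
    rw [← dist_eq_norm]
    exact (hf.2.dist_le_mul _ _).trans
      (mul_le_mul_of_nonneg_left (BoundedContinuousFunction.dist_coe_le_dist s) c.2)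
  have hfix : T hTc.fixedPoint = hTc.fixedPoint := hTc.fixedPoint_isFixedPt
  set u := hTc.fixedPoint
  have hu : ∀ t, 0 ≤ t → u t = Φ (f ∘ u) t := fun t ht => by
    conv_lhs => rw [← hfix, hT, max_eq_left ht]
  refine ⟨u, ?_, fun t ht => ?_⟩
  · rw [hu 0 le_rfl]
    simp [Φ]
  · have h := (hderiv _ (hf.2.continuous.comp u.continuous) t).hasDerivWithinAt (s := Set.Ici 0)
    rw [← hu t ht] at h
    exact h.congr (fun s hs => hu s hs) (hu t ht)

/-! ### Asynchronous discrete contraction -/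

/-- Errors that contract at update times and are constant otherwise tend to zero, provided that
every component is updated in each window of `p` steps. -/
theorem tendsto_zero_of_asynchronous_contraction {ι : Type*} [Finite ι] {c : ℝ} (hc0 : 0 ≤ c)
    (hc1 : c < 1) {T : ι → Set ℕ} {p : ℕ} (hT : ∀ i k, ∃ l ∈ T i, k ≤ l ∧ l < k + p)
    {e : ℕ → ι → ℝ} (he : ∀ k i, 0 ≤ e k i)
    (hup : ∀ k i, k ∈ T i → ∀ D, (∀ j, e k j ≤ D) → e (k + 1) i ≤ c * D)
    (hstay : ∀ k i, k ∉ T i → e (k + 1) i = e k i) (i : ι) :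
    Tendsto (fun k => e k i) atTop (𝓝 0) := by
  obtain ⟨D₀, hD₀⟩ : ∃ D, ∀ j, e 0 j ≤ D := by
    obtain ⟨D, hD⟩ := (Set.finite_range (e 0)).bddAbove
    exact ⟨D, fun j => hD ⟨j, rfl⟩⟩
  have hD₀nn : 0 ≤ D₀ := (he 0 i).trans (hD₀ i)
  have hmain : ∀ m k, p * m ≤ k → ∀ j, e k j ≤ c ^ m * D₀ := by
    intro m
    induction m with
    | zero =>
      intro k _
      simp only [pow_zero, one_mul]
      induction k with
      | zero => exact hD₀
      | succ k ih =>
        intro j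
        by_cases hj : k ∈ T j
        · exact (hup k j hj D₀ (ih (by simp))).trans (mul_le_of_le_one_left hD₀nn hc1.le)
        · rw [hstay k j hj]
          exact ih (by simp) j
    | succ m ih =>
      intro k hk j
      rw [mul_add, mul_one] at hk
      -- Here `k ≥ p * m + p`, so the subtraction is genuine and the update time `l` lies in [k - p,
      -- k), where all errors are already below c^m D₀.
      obtain ⟨l, hl, hkl, hlk⟩ := hT j (k - p)
      have hafter : ∀ r, l + 1 ≤ r → e r j ≤ c ^ (m + 1) * D₀ := by
        intro r hr
        have hupd : ∀ q, l ≤ q → q ∈ T j → e (q + 1) j ≤ c ^ (m + 1) * D₀ := fun q hq hqj => by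
          rw [pow_succ', mul_assoc]
          exact hup q j hqj _ (ih q (by omega))
        induction r, hr using Nat.le_induction with
        | base => exact hupd l le_rfl hl
        | succ r hr ihr =>
          by_cases hrj : r ∈ T j
          · exact hupd r (by omega) hrj
          · rw [hstay r j hrj]
            exact ihr
      exact hafter k (by omega)
  rw [Metric.tendsto_atTop]
  intro ε hε
  have hlim : Tendsto (fun m => c ^ m * D₀) atTop (𝓝 0) := by
    simpa using (tendsto_pow_atTop_nhds_zero_of_lt_one hc0 hc1).mul_const D₀
  obtain ⟨m, hm⟩ := (hlim.eventually (gt_mem_nhds hε)).exists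
  refine ⟨p * m, fun k hk => ?_⟩
  rw [Real.dist_eq, sub_zero, abs_of_nonneg (he k i)]
  exact (hmain m k hk i).trans_lt hm

/-! ### Equilibrium and best-response dynamics -/

namespace NetworkGame

variable {N n : ℕ} {𝒢 : NetworkGame N n}

/-- The best responses contract, with factor `c`, the maximum norm with weights `1 / w i`. -/
def BestResponseContracts (𝒢 : NetworkGame N n) (w : Fin N → ℝ) (c : ℝ) : Prop :=
  ∀ x ∈ 𝒢.feasible, ∀ y ∈ 𝒢.feasible, ∀ D, (∀ j, ‖y j - x j‖ ≤ w j * D) → ∀ i,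
    ∀ a ∈ 𝒢.bestResponse i (𝒢.aggregate x i), ∀ b ∈ 𝒢.bestResponse i (𝒢.aggregate y i),
    ‖b - a‖ ≤ c * w i * D

theorem BestResponseContracts.bestResponse_unique {w : Fin N → ℝ} {c : ℝ}
    (hcon : 𝒢.BestResponseContracts w c) {x : Profile N n} (hx : x ∈ 𝒢.feasible) {i : Fin N}
    {a b : EuclideanSpace ℝ (Fin n)} (ha : a ∈ 𝒢.bestResponse i (𝒢.aggregate x i))
    (hb : b ∈ 𝒢.bestResponse i (𝒢.aggregate x i)) : b = a := by
  have h := hcon x hx x hx 0 (by simp) i a ha b hb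
  rw [mul_zero] at h
  exact sub_eq_zero.1 (norm_le_zero_iff.1 h)

/-- In rescaled coordinates the best-response map extends to a contraction. -/
theorem Regular.exists_contractingWith (hreg : 𝒢.Regular) {w : Fin N → ℝ} {c : NNReal}
    (hw : ∀ i, 0 < w i) (hc : c < 1) (hcon : 𝒢.BestResponseContracts w c)
    (hne : ∀ x ∈ 𝒢.feasible, ∀ i, (𝒢.bestResponse i (𝒢.aggregate x i)).Nonempty) :
    ∃ f : Profile N n → Profile N n, ContractingWith c f ∧
      (∀ u i, w i • f u i ∈ 𝒢.X i) ∧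
      ∀ u : Profile N n, (fun i => w i • u i) ∈ 𝒢.feasible → ∀ i,
        w i • f u i ∈ 𝒢.bestResponse i (𝒢.aggregate (fun i => w i • u i) i) := by
  choose! B hB using hne
  choose P hP hPid hPle using fun i =>
    exists_nonexpansive_retraction (hreg.nonempty i) (hreg.closed i) (hreg.convex i)
  have hPf : ∀ u : Profile N n, (fun j => P j (w j • u j)) ∈ 𝒢.feasible := fun u j => hP j _
  have hf : ∀ (u : Profile N n) i,
      w i • (w i)⁻¹ • B (fun j => P j (w j • u j)) i = B (fun j => P j (w j • u j)) i :=
    fun u i => smul_inv_smul₀ (hw i).ne' _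
  -- Dividing by the weights turns the weighted norm into the sup norm; projecting first makes the
  -- map total at no cost in the Lipschitz constant.
  refine ⟨fun u i => (w i)⁻¹ • B (fun j => P j (w j • u j)) i,
    ⟨hc, LipschitzWith.of_dist_le_mul fun u v => ?_⟩, fun u i => ?_, fun u hu i => ?_⟩
  · refine (dist_pi_le_iff (by positivity)).2 fun i => ?_
    have h := hcon _ (hPf v) _ (hPf u) (dist u v) (fun j => by
      refine (hPle j _ _).trans ?_
      rw [← smul_sub, norm_smul, Real.norm_eq_abs, abs_of_pos (hw j), ← dist_eq_norm]
      exact mul_le_mul_of_nonneg_left (dist_le_pi_dist u v j) (hw j).le) i _ (hB _ (hPf v) i) _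
      (hB _ (hPf u) i)
    rw [dist_eq_norm, ← smul_sub, norm_smul, Real.norm_eq_abs, abs_of_pos (inv_pos.2 (hw i)),
      inv_mul_le_iff₀ (hw i)]
    exact h.trans_eq (by ring)
  · rw [hf]
    exact (hB _ (hPf u) i).1
  · have hPu : (fun j => P j (w j • u j)) = fun i => w i • u i := funext fun j => hPid j _ (hu j)
    rw [hf, hPu]
    exact hB _ hu i

theorem IsNash.mem_feasible {x : Profile N n} (hx : 𝒢.IsNash x) : x ∈ 𝒢.feasible :=
  fun i => (hx i).1

/-- Feasibility is not built into the dynamics, but the contraction estimate compares feasible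
profiles only. -/
theorem IsContinuousBR.mem_feasible (hreg : 𝒢.Regular) {x₀ : Profile N n}
    (hx₀ : x₀ ∈ 𝒢.feasible) {x : ℝ → Profile N n} (hx : 𝒢.IsContinuousBR x₀ x) {t : ℝ}
    (ht : 0 ≤ t) : x t ∈ 𝒢.feasible := fun i =>
  mem_of_relaxation (x := fun s => x s i) (hreg.closed i) (hreg.convex i)
    (by rw [hx.1]; exact hx₀ i)
    (fun s hs => by
      obtain ⟨b, hb, hd⟩ := hx.2 s hs i
      exact ⟨b, hb.1, hd⟩) ht

/-- Makes convergence to an equilibrium, and its uniqueness, instances of comparing two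
trajectories. -/
theorem IsNash.isContinuousBR {x : Profile N n} (hx : 𝒢.IsNash x) :
    𝒢.IsContinuousBR x (fun _ => x) :=
  ⟨rfl, fun t _ i => ⟨x i, hx i, by simpa using hasDerivWithinAt_const t (Set.Ici 0) (x i)⟩⟩

theorem Regular.exists_isNash (hreg : 𝒢.Regular) {w : Fin N → ℝ} {c : ℝ}
    (hw : ∀ i, 0 < w i) (hc0 : 0 ≤ c) (hc1 : c < 1) (hcon : 𝒢.BestResponseContracts w c)
    (hne : ∀ x ∈ 𝒢.feasible, ∀ i, (𝒢.bestResponse i (𝒢.aggregate x i)).Nonempty) :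
    ∃ x, 𝒢.IsNash x := by
  lift c to NNReal using hc0
  obtain ⟨f, hf, hfX, hfB⟩ := hreg.exists_contractingWith hw (NNReal.coe_lt_one.1 hc1) hcon hne
  obtain ⟨u, hfix⟩ : ∃ u, f u = u := ⟨_, hf.fixedPoint_isFixedPt⟩
  have hfeas : (fun i => w i • u i) ∈ 𝒢.feasible := fun i => by
    have h := hfX u i
    rwa [hfix] at h
  refine ⟨fun i => w i • u i, fun i => ?_⟩
  have h := hfB _ hfeas i
  rwa [hfix] at h

/-- The extended field always points towards feasible targets, so its solution stays feasible, where
the extension is the true best response. -/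
theorem Regular.exists_isContinuousBR (hreg : 𝒢.Regular) {w : Fin N → ℝ} {c : ℝ}
    (hw : ∀ i, 0 < w i) (hc0 : 0 ≤ c) (hc1 : c < 1) (hcon : 𝒢.BestResponseContracts w c)
    (hne : ∀ x ∈ 𝒢.feasible, ∀ i, (𝒢.bestResponse i (𝒢.aggregate x i)).Nonempty)
    {x₀ : Profile N n} (hx₀ : x₀ ∈ 𝒢.feasible) : ∃ x, 𝒢.IsContinuousBR x₀ x := by
  lift c to NNReal using hc0
  obtain ⟨f, hf, hfX, hfB⟩ := hreg.exists_contractingWith hw (NNReal.coe_lt_one.1 hc1) hcon hne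
  obtain ⟨u, hu0, hu⟩ := exists_relaxation_solution hf (fun i => (w i)⁻¹ • x₀ i)
  have hd : ∀ t, 0 ≤ t → ∀ i, HasDerivWithinAt (fun s => w i • u s i)
      (w i • f (u t) i - w i • u t i) (Set.Ici 0) t := fun t ht i =>
    ((hasDerivWithinAt_pi.1 (hu t ht) i).const_smul (w i)).congr_deriv (smul_sub _ _ _)
  have h0 : ∀ i, w i • u 0 i = x₀ i := fun i => by
    rw [hu0]
    exact smul_inv_smul₀ (hw i).ne' _
  have hfeas : ∀ t, 0 ≤ t → (fun i => w i • u t i) ∈ 𝒢.feasible := fun t ht i =>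
    mem_of_relaxation (x := fun s => w i • u s i) (hreg.closed i) (hreg.convex i)
      (by rw [h0]; exact hx₀ i) (fun s hs => ⟨_, hfX _ i, hd s hs i⟩) ht
  exact ⟨fun t i => w i • u t i, funext h0, fun t ht i =>
    ⟨_, hfB _ (hfeas t ht) i, hd t ht i⟩⟩

/-- Two trajectories of the continuous best-response dynamics approach each other exponentially. -/
theorem BestResponseContracts.norm_sub_le {w : Fin N → ℝ} {c : ℝ}
    (hcon : 𝒢.BestResponseContracts w c) (hreg : 𝒢.Regular) (hw : ∀ i, 0 < w i) (hc : 0 ≤ c)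
    {x₀ y₀ : Profile N n} (hx₀ : x₀ ∈ 𝒢.feasible) (hy₀ : y₀ ∈ 𝒢.feasible)
    {x y : ℝ → Profile N n} (hx : 𝒢.IsContinuousBR x₀ x) (hy : 𝒢.IsContinuousBR y₀ y) {t : ℝ}
    (ht : 0 ≤ t) (i : Fin N) :
    ‖x t i - y t i‖ ≤ w i * (‖fun j => (w j)⁻¹ • (x₀ j - y₀ j)‖ *
      Real.exp (-((1 - c) * t))) := by
  choose! p hp hpd using hx.2
  choose! q hq hqd using hy.2
  have hscale : ∀ (z : ℝ → Profile N n) (r : ℝ → Fin N → EuclideanSpace ℝ (Fin n)),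
      (∀ s, 0 ≤ s → ∀ j, HasDerivWithinAt (fun s => z s j) (r s j - z s j) (Set.Ici 0) s) →
      ∀ s, 0 ≤ s → HasDerivWithinAt (fun s j => (w j)⁻¹ • z s j : ℝ → Profile N n)
        ((fun j => (w j)⁻¹ • r s j) - fun j => (w j)⁻¹ • z s j) (Set.Ici 0) s :=
    fun z r h s hs => hasDerivWithinAt_pi.2 fun j =>
      ((h s hs j).const_smul (w j)⁻¹).congr_deriv (smul_sub _ _ _)
  have hsub : ∀ (u v : Profile N n), ((fun j => (w j)⁻¹ • u j) - fun j => (w j)⁻¹ • v j) =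
      fun j => (w j)⁻¹ • (u j - v j) := fun u v => funext fun j => (smul_sub _ _ _).symm
  have hcomp : ∀ (u : Profile N n) j, ‖u j‖ ≤ w j * ‖fun j => (w j)⁻¹ • u j‖ := fun u j => by
    have h := norm_le_pi_norm (fun j => (w j)⁻¹ • u j) j
    rwa [norm_smul, Real.norm_eq_abs, abs_of_pos (inv_pos.2 (hw j)), inv_mul_le_iff₀ (hw j)] at h
  have h := norm_sub_le_of_relaxation (c := c) (hscale x p hpd) (hscale y q hqd)
    (fun s hs => by
      rw [hsub, hsub, pi_norm_le_iff_of_nonneg (by positivity)]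
      intro j
      have h := hcon _ (hy.mem_feasible hreg hy₀ hs) _ (hx.mem_feasible hreg hx₀ hs) _
        (hcomp (x s - y s)) j _ (hq s hs j) _ (hp s hs j)
      rw [norm_smul, Real.norm_eq_abs, abs_of_pos (inv_pos.2 (hw j)), inv_mul_le_iff₀ (hw j)]
      exact h.trans_eq (by simp only [Pi.sub_apply]; ring)) ht
  rw [hsub, hsub, hx.1, hy.1] at h
  exact (hcomp (x t - y t) i).trans (mul_le_mul_of_nonneg_left h (hw i).le)

theorem IsDiscreteBR.mem_feasible {T : Fin N → Set ℕ} {x₀ : Profile N n}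
    (hx₀ : x₀ ∈ 𝒢.feasible) {x : ℕ → Profile N n} (hx : 𝒢.IsDiscreteBR T x₀ x) (k : ℕ) :
    x k ∈ 𝒢.feasible := by
  induction k with
  | zero => rwa [hx.1]
  | succ k ih =>
    intro i
    by_cases hk : k ∈ T i
    · exact ((hx.2 k i).1 hk).1
    · rw [(hx.2 k i).2 hk]
      exact ih i

theorem BestResponseContracts.existsUnique_isDiscreteBR {w : Fin N → ℝ} {c : ℝ}
    (hcon : 𝒢.BestResponseContracts w c)
    (hne : ∀ x ∈ 𝒢.feasible, ∀ i, (𝒢.bestResponse i (𝒢.aggregate x i)).Nonempty)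
    (T : Fin N → Set ℕ) {x₀ : Profile N n} (hx₀ : x₀ ∈ 𝒢.feasible) :
    ∃! x, 𝒢.IsDiscreteBR T x₀ x := by
  classical
  choose! B hB using hne
  let x : ℕ → Profile N n := fun k =>
    Nat.rec x₀ (fun k y i => if k ∈ T i then B y i else y i) k
  have hsucc : ∀ k i, x (k + 1) i = if k ∈ T i then B (x k) i else x k i := fun _ _ => rfl
  have hfeas : ∀ k, x k ∈ 𝒢.feasible := by
    intro k
    induction k with
    | zero => exact hx₀
    | succ k ih =>
      intro i
      rw [hsucc]
      split_ifs
      · exact (hB _ ih i).1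
      · exact ih i
  refine ⟨x, ⟨rfl, fun k i => ⟨fun hk => ?_, fun hk => ?_⟩⟩, fun y hy => funext fun k => ?_⟩
  · rw [hsucc, if_pos hk]
    exact hB _ (hfeas k) i
  · rw [hsucc, if_neg hk]
  · induction k with
    | zero => exact hy.1
    | succ k ih =>
      funext i
      rw [hsucc]
      split_ifs with hk
      · refine hcon.bestResponse_unique (hfeas k) (hB _ (hfeas k) i) ?_
        rw [← ih]
        exact (hy.2 k i).1 hk
      · rw [(hy.2 k i).2 hk, ih]

/-- Discrete best-response dynamics in which every player updates at least once in each window of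
`p` steps converge to the Nash equilibrium. -/
theorem BestResponseContracts.tendsto_isDiscreteBR {w : Fin N → ℝ} {c : ℝ}
    (hcon : 𝒢.BestResponseContracts w c) (hw : ∀ i, 0 < w i) (hc0 : 0 ≤ c) (hc1 : c < 1)
    {T : Fin N → Set ℕ} {p : ℕ} (hT : ∀ i k, ∃ l ∈ T i, k ≤ l ∧ l < k + p)
    {x₀ xstar : Profile N n} (hx₀ : x₀ ∈ 𝒢.feasible) (hstar : 𝒢.IsNash xstar)
    {x : ℕ → Profile N n} (hx : 𝒢.IsDiscreteBR T x₀ x) : Tendsto x atTop (𝓝 xstar) := by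
  refine tendsto_pi_nhds.2 fun i => ?_
  have h := tendsto_zero_of_asynchronous_contraction hc0 hc1 hT
    (e := fun k i => (w i)⁻¹ * ‖x k i - xstar i‖)
    (fun k i => mul_nonneg (inv_pos.2 (hw i)).le (norm_nonneg _))
    (fun k i hk D hD => by
      rw [inv_mul_le_iff₀ (hw i)]
      refine (hcon _ hstar.mem_feasible _ (hx.mem_feasible hx₀ k) D
        (fun j => (inv_mul_le_iff₀ (hw j)).1 (hD j)) i _ (hstar i) _
        ((hx.2 k i).1 hk)).trans_eq (by ring))
    (fun k i hk => by simp only [(hx.2 k i).2 hk]) i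
  have h2 := h.const_mul (w i)
  simp only [mul_inv_cancel_left₀ (hw i).ne', mul_zero] at h2
  exact tendsto_iff_norm_sub_tendsto_zero.2 h2

end NetworkGame

theorem exists_mem_sequentialTimes {N : ℕ} (i : Fin N) (k : ℕ) :
    ∃ l ∈ sequentialTimes N i, k ≤ l ∧ l < k + N := by
  have hN : 0 < N := i.pos
  have hi := i.is_lt
  have h1 := Nat.div_add_mod (k + (N - 1 - i)) N
  have h2 := Nat.mod_lt (k + (N - 1 - i)) hN
  -- The witness is the least number ≥ k congruent to `i` mod `N`.
  exact ⟨_, ⟨(k + (N - 1 - i)) / N, rfl⟩, by omega, by omega⟩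

theorem mainTheorem9 {N n : ℕ} (𝒢 : NetworkGame N n) (hreg : 𝒢.Regular)
    (hΥ : PUpsilon 𝒢.feasible (fun x => fderiv ℝ 𝒢.F x)) :
    (∀ x ∈ 𝒢.feasible, ∀ i, ∃! b, b ∈ 𝒢.bestResponse i (𝒢.aggregate x i)) ∧
    ∃ xstar : Profile N n,
      (𝒢.IsNash xstar ∧ ∀ y, 𝒢.IsNash y → y = xstar) ∧
      ∀ x₀ ∈ 𝒢.feasible,
        ((∃ x, 𝒢.IsContinuousBR x₀ x) ∧
          (∀ x y, 𝒢.IsContinuousBR x₀ x → 𝒢.IsContinuousBR x₀ y → Set.EqOn x y (Set.Ici 0)) ∧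
          (∀ x, 𝒢.IsContinuousBR x₀ x → Tendsto x atTop (𝓝 xstar))) ∧
        ((∃! x, 𝒢.IsDiscreteBR (simultaneousTimes N) x₀ x) ∧
          (∀ x, 𝒢.IsDiscreteBR (simultaneousTimes N) x₀ x → Tendsto x atTop (𝓝 xstar))) ∧
        ((∃! x, 𝒢.IsDiscreteBR (sequentialTimes N) x₀ x) ∧
          (∀ x, 𝒢.IsDiscreteBR (sequentialTimes N) x₀ x → Tendsto x atTop (𝓝 xstar))) := by

  obtain ⟨w, c, hw, hc0, hc1, hcon⟩ := hreg.exists_contraction hΥ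
  replace hcon : 𝒢.BestResponseContracts w c := hcon
  have hne : ∀ x ∈ 𝒢.feasible, ∀ i, (𝒢.bestResponse i (𝒢.aggregate x i)).Nonempty :=
    fun x hx i => hreg.bestResponse_nonempty hΥ hx i
  obtain ⟨xstar, hstar⟩ := hreg.exists_isNash hw hc0 hc1 hcon hne
  have hdecay : Tendsto (fun t : ℝ => Real.exp (-((1 - c) * t))) atTop (𝓝 0) :=
    Real.tendsto_exp_neg_atTop_nhds_zero.comp (tendsto_id.const_mul_atTop (sub_pos.2 hc1))
  have hconv : ∀ x₀ ∈ 𝒢.feasible, ∀ x, 𝒢.IsContinuousBR x₀ x → Tendsto x atTop (𝓝 xstar) := by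
    intro x₀ hx₀ x hx
    refine tendsto_pi_nhds.2 fun i => tendsto_iff_norm_sub_tendsto_zero.2 ?_
    refine squeeze_zero' (Eventually.of_forall fun _ => norm_nonneg _)
      ((eventually_ge_atTop 0).mono fun t ht => hcon.norm_sub_le hreg hw hc0 hx₀
        hstar.mem_feasible hx hstar.isContinuousBR ht i) ?_
    simpa using (hdecay.const_mul _).const_mul (w i)
  refine ⟨fun x hx i => ?_, xstar, ⟨hstar, fun y hy => ?_⟩, fun x₀ hx₀ =>
    ⟨⟨?_, fun x y hx hy t ht => funext fun i => ?_, hconv x₀ hx₀⟩,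
      ⟨hcon.existsUnique_isDiscreteBR hne _ hx₀, fun x hx =>
        hcon.tendsto_isDiscreteBR hw hc0 hc1 (p := 1) (fun i k => ⟨k, trivial, le_rfl, by simp⟩)
          hx₀ hstar hx⟩,
      ⟨hcon.existsUnique_isDiscreteBR hne _ hx₀, fun x hx =>
        hcon.tendsto_isDiscreteBR hw hc0 hc1 exists_mem_sequentialTimes hx₀ hstar hx⟩⟩⟩
  · obtain ⟨b, hb⟩ := hne x hx i
    exact ⟨b, hb, fun a ha => hcon.bestResponse_unique hx hb ha⟩
  -- Another equilibrium is a constant trajectory, yet it must converge to `xstar`.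
  · exact tendsto_nhds_unique tendsto_const_nhds
      (hconv y hy.mem_feasible _ hy.isContinuousBR)
  · exact hreg.exists_isContinuousBR hw hc0 hc1 hcon hne hx₀
  · have h := hcon.norm_sub_le hreg hw hc0 hx₀ hx₀ hx hy ht i
    simp only [sub_self, smul_zero] at h
    have hz : ‖(fun _ : Fin N => (0 : EuclideanSpace ℝ (Fin n)))‖ = 0 := norm_zero
    rw [hz, zero_mul, mul_zero] at h
    exact sub_eq_zero.1 (norm_le_zero_iff.1 h)
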